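/- Let $X$ be a metric space which is standard Borel (that is, a Borel subset of a separable complete metric space), and let $(\phi_t)_{t\in\mathbb R}$ be a continuous flow on $X$ satisfying the closing lemma: every point $v\in X$ has a neighbourhood $V$ such that for all $\varepsilon>0$ there exist $\delta>0$ and $t_0>0$ such that for all $x\in V$ and all $t>t_0$ with $d(x,\phi_t x)<\delta$ and $\phi_t x\in V$, there exist $x_0\in X$ and $l>0$ with $|l-t|<\varepsilon$, $\phi_l x_0=x_0$, and $d(\phi_s x_0,\phi_s x)<\varepsilon$ for all $0<s<\min(t,l)$. For a point $x$ and $l>0$ with $\phi_l x=x$, the normalized Dirac measure on the periodic orbit of $x$ is the Borel probability measure $\delta_x$ on $X$ with $\int f\,d\delta_x=\frac1l\int_0^l f(\phi_s x)\,ds$ for all bounded continuous $f$ (fixed points count as periodic orbits). Let $\mathcal M^1(X)$ be the set of all Borel probability measures on $X$ that are invariant under $\phi_t$ for every $t\in\mathbb R$, with the weak topology (convergence of integrals of bounded continuous functions). Then the convex hull of the set of normalized Dirac measures on periodic orbits is contained in $\mathcal M^1(X)$ and is dense in $\mathcal M^1(X)$. -/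

import Mathlib

open Set MeasureTheory Topology
open scoped NNReal ENNReal

/-- A continuous flow `φ` on a metric space `X` satisfies the closing lemma: locally, long orbit
segments that return close to their initial point are shadowed by periodic orbits. -/
def SatisfiesClosingLemma {X : Type*} [MetricSpace X] (φ : Flow ℝ X) : Prop :=
  ∀ v : X, ∃ V ∈ 𝓝 v, ∀ ε : ℝ, 0 < ε → ∃ δ : ℝ, 0 < δ ∧ ∃ t₀ : ℝ, 0 < t₀ ∧
    ∀ x ∈ V, ∀ t : ℝ, t₀ < t → dist x (φ t x) < δ → φ t x ∈ V →
      ∃ x₀ : X, ∃ l : ℝ, 0 < l ∧ |l - t| < ε ∧ φ l x₀ = x₀ ∧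
        ∀ s : ℝ, 0 < s → s < min t l → dist (φ s x₀) (φ s x) < ε

/-- The measure `A ↦ (1 / l) * Leb {s ∈ (0, l] | φ s x ∈ A}`. When `l > 0` is a period of `x`, this
is the normalized Dirac measure on the periodic orbit of `x`, and it does not depend on the choice
of the period `l` nor on that of the point `x` on the orbit. -/
noncomputable def orbitMeasure {X : Type*} [MetricSpace X] [MeasurableSpace X]
    (φ : Flow ℝ X) (x : X) (l : ℝ) : Measure X :=
  (ENNReal.ofReal l)⁻¹ • (volume.restrict (Ioc 0 l)).map (fun s : ℝ => φ s x)

/-- The set of normalized Dirac measures on the periodic orbits of `φ`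
(fixed points count as periodic orbits). -/
def periodicOrbitMeasures {X : Type*} [MetricSpace X] [MeasurableSpace X]
    (φ : Flow ℝ X) : Set (Measure X) :=
  {m | ∃ x : X, ∃ l : ℝ, 0 < l ∧ φ l x = x ∧ m = orbitMeasure φ x l}

/-- The set of Borel probability measures invariant under the flow `φ`; as a subset of
`ProbabilityMeasure X` it carries the topology of weak convergence. -/
def invariantProbabilityMeasures {X : Type*} [MetricSpace X] [MeasurableSpace X]
    (φ : Flow ℝ X) : Set (ProbabilityMeasure X) :=
  {μ | ∀ t : ℝ, MeasurePreserving (φ t) (μ : Measure X) (μ : Measure X)}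

open Filter
open scoped BoundedContinuousFunction

/-! By Hahn–Banach in finite dimensions, density reduces to one inequality: a bound `c` on the
integrals of a bounded continuous `f` over all periodic orbits also bounds `∫ f dμ` for every
invariant `μ`. Lipschitz minorants reduce this to Lipschitz `f`. By Poincaré recurrence for the
time-one map, almost every orbit returns near its start at large integer times `n`. The closing
lemma shadows that segment by a periodic orbit, so its time integral is less than `n * (c + η)`. One
such `n` per point suffices: the maximal ergodic inequality turns this into `∫ f dμ ≤ c + η`.
Neither ergodic decomposition nor convergence of Birkhoff averages enters. -/

/-- A metric space whose Borel `σ`-algebra is standard Borel is second countable. -/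
theorem secondCountableTopology_of_metric_standardBorel (X : Type*) [MetricSpace X]
    [MeasurableSpace X] [BorelSpace X] [StandardBorelSpace X] : SecondCountableTopology X := by
  refine Metric.secondCountable_of_almost_dense_set fun ε hε => ?_
  obtain ⟨D, hD⟩ := zorn_subset {D : Set X | D.Pairwise fun x y => ε ≤ dist x y}
    (fun c hc hchain => ⟨⋃₀ c, (pairwise_sUnion hchain.directedOn).2 hc,
      fun s hs => subset_sUnion_of_mem hs⟩)
  -- Every subset of an `ε`-separated set is closed, so all subsets of `D` are Borel.
  have hsub : ∀ S ⊆ D, MeasurableSet S := fun S hS =>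
    (Metric.isClosed_of_pairwise_le_dist hε (hD.prop.mono hS)).measurableSet
  refine ⟨D, ?_, fun x => ?_⟩
  · by_contra hcount
    have : StandardBorelSpace D := (hsub D subset_rfl).standardBorel
    -- An uncountable `D` would make all `2 ^ 𝔠` subsets of `ℝ` Borel, but there are only `𝔠` Borel
    -- sets.
    have e : D ≃ᵐ ℝ := PolishSpace.measurableEquivOfNotCountable
      (fun h => hcount (countable_coe_iff.1 h)) (not_countable (α := ℝ))
    have hall : ∀ S : Set ℝ, MeasurableSet S := fun S => by
      rw [← e.measurableSet_preimage]
      have h := hsub (Subtype.val '' (e ⁻¹' S)) (by simp)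
      have h2 : MeasurableSet (Subtype.val ⁻¹' (Subtype.val '' (e ⁻¹' S)) : Set D) :=
        measurable_subtype_coe h
      rwa [preimage_image_eq _ Subtype.val_injective] at h2
    obtain ⟨b, hb, hgen⟩ := MeasurableSpace.CountablyGenerated.isCountablyGenerated (α := ℝ)
    have h1 : Cardinal.mk {t : Set ℝ | @MeasurableSet ℝ (MeasurableSpace.generateFrom b) t} ≤
        Cardinal.continuum :=
      MeasurableSpace.cardinal_measurableSet_le_continuum
        ((Cardinal.le_aleph0_iff_set_countable.2 hb).trans Cardinal.aleph0_le_continuum)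
    rw [← hgen] at h1
    have h2 : {t : Set ℝ | MeasurableSet t} = univ := eq_univ_of_forall hall
    rw [h2, Cardinal.mk_univ, Cardinal.mk_set, Cardinal.mk_real] at h1
    exact absurd (Cardinal.cantor Cardinal.continuum) h1.not_gt
  · by_contra! h
    have hx : insert x D ∈ {D : Set X | D.Pairwise fun x y => ε ≤ dist x y} := by
      refine hD.prop.insert fun y hy _ => ?_
      have := (h y hy).le
      exact ⟨this, by rwa [dist_comm]⟩
    have hxD : x ∈ D := hD.le_of_ge hx (subset_insert x D) (mem_insert x D)
    have := h x hxD
    simp at this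
    linarith

/-! ### Maximal ergodic inequality -/

/-- The maximum of the first `N + 1` Birkhoff sums, given by its recursion along the orbit. -/
def maxBirkhoffSum {α : Type*} (T : α → α) (g : α → ℝ) : ℕ → α → ℝ
  | 0, _ => 0
  | N + 1, x => max 0 (g x + maxBirkhoffSum T g N (T x))

section MaximalErgodic

variable {α : Type*} {T : α → α} {g : α → ℝ}

theorem maxBirkhoffSum_nonneg (N : ℕ) (x : α) : 0 ≤ maxBirkhoffSum T g N x := by
  cases N with
  | zero => exact le_rfl
  | succ N => exact le_max_left _ _

theorem maxBirkhoffSum_le_succ (N : ℕ) (x : α) :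
    maxBirkhoffSum T g N x ≤ maxBirkhoffSum T g (N + 1) x := by
  induction N generalizing x with
  | zero => exact le_max_left _ _
  | succ N ih => exact max_le_max le_rfl (add_le_add le_rfl (ih (T x)))

theorem birkhoffSum_le_maxBirkhoffSum (N : ℕ) (x : α) :
    birkhoffSum T g N x ≤ maxBirkhoffSum T g N x := by
  induction N generalizing x with
  | zero => simp [maxBirkhoffSum]
  | succ N ih =>
    rw [birkhoffSum_succ']
    exact (add_le_add le_rfl (ih (T x))).trans (le_max_right _ _)

variable [MeasurableSpace α] {μ : Measure α}

theorem measurable_maxBirkhoffSum (hT : Measurable T) (hg : Measurable g) (N : ℕ) :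
    Measurable (maxBirkhoffSum T g N) := by
  induction N with
  | zero => exact measurable_const
  | succ N ih => exact measurable_const.max (hg.add (ih.comp hT))

theorem integrable_maxBirkhoffSum (hT : MeasurePreserving T μ μ) (hg : Integrable g μ) (N : ℕ) :
    Integrable (maxBirkhoffSum T g N) μ := by
  induction N with
  | zero => exact integrable_zero _ _ _
  | succ N ih =>
    exact (integrable_zero _ _ _).sup (hg.add (hT.integrable_comp_of_integrable ih))

/-- The maximal ergodic inequality for finitely many Birkhoff sums. -/
theorem integral_indicator_maxBirkhoffSum_nonneg (hT : MeasurePreserving T μ μ)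
    (hg : Integrable g μ) (hgm : Measurable g) (N : ℕ) :
    0 ≤ ∫ x, {x | 0 < maxBirkhoffSum T g N x}.indicator g x ∂μ := by
  have hint := integrable_maxBirkhoffSum hT hg N
  have hintT : Integrable (fun x => maxBirkhoffSum T g N (T x)) μ :=
    hT.integrable_comp_of_integrable hint
  have hmeas := measurable_maxBirkhoffSum hT.measurable hgm N
  have hzero : ∫ x, (maxBirkhoffSum T g N x - maxBirkhoffSum T g N (T x)) ∂μ = 0 := by
    rw [integral_sub hint hintT, ← integral_map (φ := T) hT.aemeasurable
      (by rw [hT.map_eq]; exact hint.1), hT.map_eq, sub_self]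
  -- Garsia's argument: with `M_N` the maximum, `M_N - M_N ∘ T` is at most `g` where `M_N > 0`, and
  -- at most `0` elsewhere.
  refine hzero.symm.le.trans (integral_mono (hint.sub hintT)
    (hg.indicator (measurableSet_lt measurable_const hmeas)) fun x => ?_)
  by_cases hx : 0 < maxBirkhoffSum T g N x
  · simp only [indicator, mem_ofPred_eq, hx, if_true]
    cases N with
    | zero => exact absurd hx (lt_irrefl _)
    | succ N =>
      have h1 := maxBirkhoffSum_le_succ (T := T) (g := g) N (T x)
      have h2 : maxBirkhoffSum T g (N + 1) x = g x + maxBirkhoffSum T g N (T x) :=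
        max_eq_right (by
          by_contra! h
          exact hx.ne' (max_eq_left h.le))
      linarith
  · have h1 := maxBirkhoffSum_nonneg (T := T) (g := g) N (T x)
    simp only [indicator, mem_ofPred_eq, hx, if_false]
    linarith

/-- If almost every point has a positive Birkhoff sum, the integral is nonnegative. -/
theorem integral_nonneg_of_ae_exists_birkhoffSum_pos (hT : MeasurePreserving T μ μ)
    (hg : Integrable g μ) (hgm : Measurable g) (h : ∀ᵐ x ∂μ, ∃ n, 0 < birkhoffSum T g n x) :
    0 ≤ ∫ x, g x ∂μ := by
  refine ge_of_tendsto' (tendsto_integral_of_dominated_convergence (fun x => ‖g x‖)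
    (fun N => (hg.indicator (measurableSet_lt measurable_const
      (measurable_maxBirkhoffSum hT.measurable hgm N))).1) hg.norm
    (fun N => Eventually.of_forall fun x => norm_indicator_le_norm_self _ _) ?_)
    (integral_indicator_maxBirkhoffSum_nonneg hT hg hgm)
  filter_upwards [h] with x hx
  obtain ⟨n, hn⟩ := hx
  refine tendsto_const_nhds.congr' ?_
  filter_upwards [eventually_ge_atTop n] with N hN
  have hpos : 0 < maxBirkhoffSum T g N x :=
    (hn.trans_le (birkhoffSum_le_maxBirkhoffSum n x)).trans_le
      (monotone_nat_of_le_succ (f := fun N => maxBirkhoffSum T g N x)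
        (fun N => maxBirkhoffSum_le_succ N x) hN)
  exact (indicator_of_mem (s := {x | 0 < maxBirkhoffSum T g N x}) hpos g).symm

end MaximalErgodic

/-! ### Periodic orbit measures and separation -/

section OrbitMeasure

variable {X : Type*} [MetricSpace X]

theorem continuous_flow_orbit (φ : Flow ℝ X) (x : X) : Continuous fun s : ℝ => φ s x :=
  φ.continuous continuous_id continuous_const

variable [MeasurableSpace X] [BorelSpace X] {φ : Flow ℝ X}

theorem isProbabilityMeasure_orbitMeasure (φ : Flow ℝ X) (x : X) {l : ℝ} (hl : 0 < l) :
    IsProbabilityMeasure (orbitMeasure φ x l) := by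
  constructor
  rw [orbitMeasure, Measure.smul_apply,
    Measure.map_apply (continuous_flow_orbit φ x).measurable MeasurableSet.univ]
  simp only [preimage_univ, Measure.restrict_apply_univ, Real.volume_Ioc, sub_zero, smul_eq_mul]
  exact ENNReal.inv_mul_cancel (by simpa using hl) ENNReal.ofReal_ne_top

theorem integral_orbitMeasure (φ : Flow ℝ X) (x : X) {l : ℝ} (hl : 0 < l) {f : X → ℝ}
    (hf : Continuous f) :
    ∫ y, f y ∂orbitMeasure φ x l = l⁻¹ * ∫ s in (0 : ℝ)..l, f (φ s x) := by
  rw [orbitMeasure, integral_smul_measure, (continuous_flow_orbit φ x).measurable.aemeasurable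
    |> fun h => integral_map h hf.measurable.stronglyMeasurable.aestronglyMeasurable,
    intervalIntegral.integral_of_le hl.le, ENNReal.toReal_inv, ENNReal.toReal_ofReal hl.le,
    smul_eq_mul]

/-- The flow translates the time parameter, and the integral of an `l`-periodic function over a
period does not depend on where it starts. -/
theorem map_flow_orbitMeasure {x : X} {l : ℝ} (hl : 0 < l) (hx : φ l x = x) (t : ℝ) :
    (orbitMeasure φ x l).map (φ t) = orbitMeasure φ x l := by
  have := isProbabilityMeasure_orbitMeasure φ x hl
  have hφ : Continuous (φ t) := φ.continuous_toFun t
  have := Measure.isProbabilityMeasure_map (μ := orbitMeasure φ x l) hφ.measurable.aemeasurable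
  refine ext_of_forall_integral_eq_of_IsFiniteMeasure fun f => ?_
  rw [integral_map hφ.measurable.aemeasurable
    f.continuous.measurable.stronglyMeasurable.aestronglyMeasurable,
    integral_orbitMeasure φ x hl (f := fun y => f (φ t y)) (f.continuous.comp hφ),
    integral_orbitMeasure φ x hl f.continuous]
  congr 1
  have hper : Function.Periodic (fun s => f (φ s x)) l := fun s => by
    simp only [Flow.map_add, hx]
  have h1 := hper.intervalIntegral_add_eq t 0
  rw [zero_add] at h1
  rw [← h1]
  simp only [← Flow.map_add]
  rw [intervalIntegral.integral_comp_add_left (fun s => f (φ s x)), add_zero]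

theorem periodicOrbitMeasures_subset_image :
    periodicOrbitMeasures φ ⊆
      (fun μ : ProbabilityMeasure X => (μ : Measure X)) '' invariantProbabilityMeasures φ := by
  rintro _ ⟨x, l, hl, hx, rfl⟩
  exact ⟨⟨_, isProbabilityMeasure_orbitMeasure φ x hl⟩,
    fun t => ⟨(φ.continuous_toFun t).measurable, map_flow_orbitMeasure hl hx t⟩, rfl⟩

theorem convex_image_invariantProbabilityMeasures (φ : Flow ℝ X) :
    Convex ℝ≥0
      ((fun μ : ProbabilityMeasure X => (μ : Measure X)) '' invariantProbabilityMeasures φ) := by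
  rintro _ ⟨μ, hμ, rfl⟩ _ ⟨ν, hν, rfl⟩ a b _ _ hab
  have hprob : IsProbabilityMeasure (a • (μ : Measure X) + b • (ν : Measure X)) := by
    constructor
    simp only [Measure.add_apply, Measure.smul_apply, measure_univ, ENNReal.smul_def, smul_eq_mul,
      mul_one]
    exact_mod_cast hab
  refine ⟨⟨_, hprob⟩, fun t => ⟨(φ.continuous_toFun t).measurable, ?_⟩, rfl⟩
  change Measure.map (φ t) (a • (μ : Measure X) + b • (ν : Measure X)) = _
  rw [Measure.map_add _ _ (φ.continuous_toFun t).measurable, Measure.map_smul, Measure.map_smul,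
    (hμ t).map_eq, (hν t).map_eq]
  rfl

theorem convexHull_periodicOrbitMeasures_subset (φ : Flow ℝ X) :
    convexHull ℝ≥0 (periodicOrbitMeasures φ) ⊆
      (fun μ : ProbabilityMeasure X => (μ : Measure X)) '' invariantProbabilityMeasures φ :=
  convexHull_min periodicOrbitMeasures_subset_image (convex_image_invariantProbabilityMeasures φ)

theorem isProbabilityMeasure_of_mem_convexHull {m : Measure X}
    (hm : m ∈ convexHull ℝ≥0 (periodicOrbitMeasures φ)) : IsProbabilityMeasure m := by
  obtain ⟨μ, _, rfl⟩ := convexHull_periodicOrbitMeasures_subset φ hm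
  exact inferInstanceAs (IsProbabilityMeasure (μ : Measure X))

/-- By finite-dimensional separation, an invariant measure is a weak limit of convex combinations
of periodic measures once every upper bound for the periodic integrals of a bounded continuous
function is an upper bound for its integral. -/
theorem mem_closure_of_forall_integral_le (φ : Flow ℝ X) (μ : invariantProbabilityMeasures φ)
    (h : ∀ (f : X →ᵇ ℝ) (c : ℝ), (∀ m ∈ periodicOrbitMeasures φ, ∫ x, f x ∂m ≤ c) →
      ∫ x, f x ∂((μ : ProbabilityMeasure X) : Measure X) ≤ c) :
    μ ∈ closure {μ : invariantProbabilityMeasures φ |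
      ((μ : ProbabilityMeasure X) : Measure X) ∈ convexHull ℝ≥0 (periodicOrbitMeasures φ)} := by
  classical
  let J : invariantProbabilityMeasures φ → (X →ᵇ ℝ) → ℝ :=
    fun ν f => ∫ x, f x ∂((ν : ProbabilityMeasure X) : Measure X)
  -- A basic weak neighbourhood tests only finitely many functions, which brings the problem to `I →
  -- ℝ`.
  have hJ : IsInducing J := by
    rw [isInducing_iff_nhds]
    intro ν
    refine le_antisymm ?_ ?_
    · refine Tendsto.le_comap (tendsto_pi_nhds.2 fun f => ?_)
      exact ProbabilityMeasure.tendsto_iff_forall_integral_tendsto.1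
        (continuous_subtype_val.tendsto ν) f
    · refine (IsInducing.subtypeVal.nhds_eq_comap ν).symm ▸ ?_
      rw [← tendsto_iff_comap, ProbabilityMeasure.tendsto_iff_forall_integral_tendsto]
      exact fun f => ((continuous_apply f).tendsto (J ν)).comp tendsto_comap
  rw [hJ.closure_eq_preimage_closure_image, mem_preimage, mem_closure_iff_nhds]
  intro U hU
  rw [nhds_pi, Filter.mem_pi] at hU
  obtain ⟨I, hI, t, ht, htU⟩ := hU
  have := hI.fintype
  let Φ : Measure X → I → ℝ := fun m f => ∫ x, (f : X →ᵇ ℝ) x ∂m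
  have hconv : Convex ℝ (Φ '' convexHull ℝ≥0 (periodicOrbitMeasures φ)) := by
    rintro _ ⟨m, hm, rfl⟩ _ ⟨n, hn, rfl⟩ a b ha hb hab
    lift a to ℝ≥0 using ha
    lift b to ℝ≥0 using hb
    have := isProbabilityMeasure_of_mem_convexHull hm
    have := isProbabilityMeasure_of_mem_convexHull hn
    refine ⟨a • m + b • n, convex_convexHull ℝ≥0 _ hm hn a.2 b.2 (by exact_mod_cast hab), ?_⟩
    ext f
    simp only [Φ, Pi.add_apply, Pi.smul_apply]
    rw [integral_add_measure ((f : X →ᵇ ℝ).integrable _) ((f : X →ᵇ ℝ).integrable _),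
      integral_smul_nnreal_measure, integral_smul_nnreal_measure]
    rfl
  have hmem : Φ ((μ : ProbabilityMeasure X) : Measure X) ∈
      closure (Φ '' convexHull ℝ≥0 (periodicOrbitMeasures φ)) := by
    by_contra hnot
    obtain ⟨L, u, hLu, huL⟩ := geometric_hahn_banach_closed_point hconv.closure isClosed_closure
      hnot
    -- The separating functional is itself integration against one bounded continuous function.
    let F : X →ᵇ ℝ := ∑ f : I, L (Pi.single f 1) • (f : X →ᵇ ℝ)
    have hF : ∀ (m : Measure X) [IsProbabilityMeasure m], ∫ x, F x ∂m = L (Φ m) := fun m _ => by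
      have h1 : L (Φ m) = ∑ f : I, Φ m f * L (Pi.single f 1) := by
        conv_lhs => rw [← Finset.univ_sum_single (Φ m), map_sum]
        refine Finset.sum_congr rfl fun f _ => ?_
        rw [← smul_eq_mul, ← map_smul, ← Pi.single_smul, smul_eq_mul, mul_one]
      simp only [F, BoundedContinuousFunction.coe_sum, Finset.sum_apply,
        BoundedContinuousFunction.coe_smul, smul_eq_mul]
      rw [integral_finsetSum (f := fun (f : I) x => L (Pi.single f 1) * (f : X →ᵇ ℝ) x) _
        fun f _ => ((f : X →ᵇ ℝ).integrable m).const_mul _, h1]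
      exact Finset.sum_congr rfl fun f _ => by rw [integral_const_mul, mul_comm]
    have hle := h F u fun m hm => by
      have hm' := subset_convexHull ℝ≥0 _ hm
      have := isProbabilityMeasure_of_mem_convexHull hm'
      rw [hF m]
      exact (hLu _ (subset_closure (mem_image_of_mem Φ hm'))).le
    rw [hF] at hle
    exact huL.not_ge hle
  obtain ⟨_, hpt, m, hm, rfl⟩ := mem_closure_iff_nhds.1 hmem
    (univ.pi fun f : I => t f) (set_pi_mem_nhds finite_univ fun f _ => ht f)
  obtain ⟨ν, hν, rfl⟩ := convexHull_periodicOrbitMeasures_subset φ hm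
  exact ⟨J ⟨ν, hν⟩, htU fun f hf => hpt ⟨f, hf⟩ trivial, mem_image_of_mem J hm⟩

end OrbitMeasure

/-! ### Lipschitz approximation from below -/

section LipschitzApproximation

variable {X : Type*} [MetricSpace X]

/-- The largest `k`-Lipschitz minorant of `f`. -/
noncomputable def lipschitzMinorant (f : X → ℝ) (k : ℝ≥0) (x : X) : ℝ :=
  ⨅ y, (f y + k * dist x y)

variable {f : X → ℝ} {M : ℝ}

theorem le_add_mul_dist (hM : ∀ x, |f x| ≤ M) (k : ℝ≥0) (x y : X) : -M ≤ f y + k * dist x y :=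
  (neg_le_of_abs_le (hM y)).trans (le_add_of_nonneg_right (by positivity))

theorem bddBelow_range_add_mul_dist (hM : ∀ x, |f x| ≤ M) (k : ℝ≥0) (x : X) :
    BddBelow (range fun y => f y + k * dist x y) :=
  ⟨-M, forall_mem_range.2 (le_add_mul_dist hM k x)⟩

theorem lipschitzMinorant_le (hM : ∀ x, |f x| ≤ M) (k : ℝ≥0) (x : X) :
    lipschitzMinorant f k x ≤ f x :=
  (ciInf_le (bddBelow_range_add_mul_dist hM k x) x).trans (by simp)

theorem abs_lipschitzMinorant_le (hM : ∀ x, |f x| ≤ M) (k : ℝ≥0) (x : X) :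
    |lipschitzMinorant f k x| ≤ M :=
  have : Nonempty X := ⟨x⟩
  abs_le.2 ⟨le_ciInf (le_add_mul_dist hM k x),
    (lipschitzMinorant_le hM k x).trans (le_of_abs_le (hM x))⟩

theorem lipschitzWith_lipschitzMinorant (hM : ∀ x, |f x| ≤ M) (k : ℝ≥0) :
    LipschitzWith k (lipschitzMinorant f k) := by
  refine LipschitzWith.of_le_add_mul k fun x y => ?_
  have : Nonempty X := ⟨x⟩
  rw [← sub_le_iff_le_add]
  refine le_ciInf fun z => ?_
  rw [sub_le_iff_le_add]
  refine (ciInf_le (bddBelow_range_add_mul_dist hM k x) z).trans ?_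
  have := mul_le_mul_of_nonneg_left (dist_triangle x y z) k.2
  simp only [NNReal.val_eq_coe] at this
  linarith

theorem tendsto_lipschitzMinorant (hf : Continuous f) (hM : ∀ x, |f x| ≤ M) (x : X) :
    Tendsto (fun k : ℕ => lipschitzMinorant f k x) atTop (𝓝 (f x)) := by
  have : Nonempty X := ⟨x⟩
  refine Metric.tendsto_atTop.2 fun ε hε => ?_
  obtain ⟨δ, hδ, hfδ⟩ := Metric.continuous_iff.1 hf x (ε / 2) (half_pos hε)
  -- For `k ≥ N` the penalty at distance at least `δ` is at least `2 * M`, so far points cannot pull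
  -- the infimum below `f x`.
  obtain ⟨N, hN⟩ := exists_nat_ge (2 * M / δ)
  refine ⟨N, fun k hk => ?_⟩
  have hlow : f x - ε / 2 ≤ lipschitzMinorant f k x := by
    refine le_ciInf fun y => ?_
    rcases lt_or_ge (dist x y) δ with h | h
    · have h1 := abs_lt.1 (hfδ y (by rwa [dist_comm]))
      have h2 : 0 ≤ ((k : ℝ≥0) : ℝ) * dist x y := by positivity
      linarith [h1.1]
    · have h1 : 2 * M ≤ (k : ℝ) * δ := by
        rw [← div_le_iff₀ hδ]
        exact hN.trans (by exact_mod_cast hk)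
      have h2 : (k : ℝ) * δ ≤ ((k : ℝ≥0) : ℝ) * dist x y := by
        rw [NNReal.coe_natCast]
        gcongr
      linarith [le_of_abs_le (hM x), neg_le_of_abs_le (hM y)]
  rw [Real.dist_eq, abs_sub_comm, abs_of_nonneg (sub_nonneg.2 (lipschitzMinorant_le hM k x))]
  linarith

end LipschitzApproximation

/-! ### Time integrals along orbits -/

/-- The integrands are compared up to `min t l`; only one of the two integrals has a remainder, of
length `|l - t|`. -/
theorem intervalIntegral_le_of_shadowing {a b : ℝ → ℝ} (ha : Continuous a) (hb : Continuous b)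
    {M κ t l : ℝ} (ht : 0 ≤ t) (hl : 0 ≤ l) (haM : ∀ s, |a s| ≤ M) (hbM : ∀ s, |b s| ≤ M)
    (hab : ∀ s, 0 < s → s < min t l → a s ≤ b s + κ) :
    ∫ s in (0 : ℝ)..t, a s ≤ (∫ s in (0 : ℝ)..l, b s) + κ * min t l + M * |l - t| := by
  have hmin : ∫ s in (0 : ℝ)..min t l, a s ≤ (∫ s in (0 : ℝ)..min t l, b s) + κ * min t l := by
    have h1 := intervalIntegral.integral_mono_on_of_le_Ioo (μ := volume) (f := a)
      (g := fun s => b s + κ) (le_min ht hl)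
      (ha.intervalIntegrable _ _) ((hb.add continuous_const).intervalIntegrable _ _)
      fun s hs => hab s hs.1 hs.2
    rwa [intervalIntegral.integral_add (hb.intervalIntegrable _ _)
      (continuous_const.intervalIntegrable _ _), intervalIntegral.integral_const, sub_zero,
      smul_eq_mul, mul_comm] at h1
  have hA := intervalIntegral.norm_integral_le_of_norm_le_const (a := min t l) (b := t) (f := a) (C := M)
    fun s _ => haM s
  have hB := intervalIntegral.norm_integral_le_of_norm_le_const (a := min t l) (b := l) (f := b) (C := M)
    fun s _ => hbM s
  rw [← intervalIntegral.integral_add_adjacent_intervals (ha.intervalIntegrable 0 (min t l))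
      (ha.intervalIntegrable _ t),
    ← intervalIntegral.integral_add_adjacent_intervals (hb.intervalIntegrable 0 (min t l))
      (hb.intervalIntegrable _ l)]
  have h1 := (abs_le.1 hA).2
  have h2 := (abs_le.1 hB).1
  have h3 : |t - min t l| + |l - min t l| = |l - t| := by
    rcases le_total t l with h | h
    · simp [min_eq_left h]
    · simp [min_eq_right h, abs_sub_comm]
  rw [← h3]
  linarith

theorem iterate_flow_one {X : Type*} [TopologicalSpace X] (φ : Flow ℝ X) (n : ℕ) (x : X) :
    (φ 1)^[n] x = φ n x := by
  induction n with
  | zero => simp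
  | succ n ih => rw [Function.iterate_succ_apply', ih, ← Flow.map_add, Nat.cast_succ, add_comm]

theorem birkhoffSum_integral_flow {X : Type*} [TopologicalSpace X] (φ : Flow ℝ X) {f : X → ℝ}
    (hf : Continuous f) (a : ℝ) (n : ℕ) (x : X) :
    birkhoffSum (φ 1) (fun y => a - ∫ s in (0 : ℝ)..1, f (φ s y)) n x =
      n * a - ∫ s in (0 : ℝ)..n, f (φ s x) := by
  have hcont : Continuous fun s : ℝ => f (φ s x) := hf.comp (φ.continuous continuous_id continuous_const)
  induction n with
  | zero => simp
  | succ n ih =>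
    rw [birkhoffSum_succ, ih, iterate_flow_one]
    simp only [← Flow.map_add]
    rw [intervalIntegral.integral_comp_add_right (fun s => f (φ s x)), zero_add, Nat.cast_succ,
      ← intervalIntegral.integral_add_adjacent_intervals (hcont.intervalIntegrable 0 n)
        (hcont.intervalIntegrable _ (n + 1)), add_comm (1 : ℝ) n]
    ring

/-! ### From the closing lemma to the integral bound -/

section Closing

variable {X : Type*} [MetricSpace X] [MeasurableSpace X] [BorelSpace X] {φ : Flow ℝ X}

/-- Along a recurrent orbit, some Birkhoff integral is controlled by the periodic integrals. -/
theorem SatisfiesClosingLemma.exists_integral_lt (hφ : SatisfiesClosingLemma φ) {f : X → ℝ}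
    {K : ℝ≥0} {M c η : ℝ} (hf : LipschitzWith K f) (hM : ∀ x, |f x| ≤ M) (hη : 0 < η)
    (hc : ∀ m ∈ periodicOrbitMeasures φ, ∫ y, f y ∂m ≤ c) {x : X}
    (hx : ∀ s ∈ 𝓝 x, ∃ᶠ n : ℕ in atTop, φ n x ∈ s) :
    ∃ n : ℕ, ∫ s in (0 : ℝ)..n, f (φ s x) < n * (c + η) := by
  obtain ⟨V, hV, hclose⟩ := hφ x
  have hM0 : 0 ≤ M := (abs_nonneg _).trans (hM x)
  have hD : 0 < |c| + M + K + 1 := by positivity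
  -- Shadowing costs at most `K * ε * n`, and the mismatch between `l` and `n` costs `ε * (|c| +
  -- M)`, absorbed using `n > 1`. The summand `1` makes the final inequality strict.
  let ε := η / (|c| + M + K + 1)
  have hε : 0 < ε := div_pos hη hD
  have hεη : ε * (|c| + M + K + 1) = η := div_mul_cancel₀ _ hD.ne'
  obtain ⟨δ, hδ, t₀, ht₀, hclose⟩ := hclose ε hε
  obtain ⟨n, hn, hnt⟩ := ((hx _ (inter_mem hV (Metric.ball_mem_nhds x hδ))).and_eventually
    (tendsto_natCast_atTop_atTop.eventually_gt_atTop (max t₀ 1))).exists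
  obtain ⟨x₀, l, hl, hlt, hper, hshadow⟩ := hclose x (mem_of_mem_nhds hV) n
    ((le_max_left _ _).trans_lt hnt) (by rw [dist_comm]; exact hn.2) hn.1
  have hn1 : (1 : ℝ) < n := (le_max_right _ _).trans_lt hnt
  refine ⟨n, ?_⟩
  have h1 := intervalIntegral_le_of_shadowing (κ := K * ε) (t := n) (l := l)
    (hf.continuous.comp (continuous_flow_orbit φ x))
    (hf.continuous.comp (continuous_flow_orbit φ x₀)) (by positivity) hl.le
    (fun s => hM _) (fun s => hM _) (fun s hs hs' => by
      have h := (le_abs_self _).trans (hf.dist_le_mul (φ s x) (φ s x₀))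
      have h' : K * dist (φ s x) (φ s x₀) ≤ K * ε := by
        rw [dist_comm]
        exact mul_le_mul_of_nonneg_left (hshadow s hs hs').le K.2
      simp only [Function.comp_apply]
      linarith)
  have h2 := hc _ ⟨x₀, l, hl, hper, rfl⟩
  rw [integral_orbitMeasure φ x₀ hl hf.continuous, inv_mul_le_iff₀ hl] at h2
  simp only [Function.comp_apply] at h1
  have h3 : l * c ≤ n * c + ε * |c| := by
    have : (l - n) * c ≤ ε * |c| := (le_abs_self _).trans (by rw [abs_mul]; gcongr)
    linarith
  have h4 : K * ε * min (n : ℝ) l ≤ K * ε * n := by gcongr; exact min_le_left _ _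
  have h5 : M * |l - n| ≤ M * ε := by gcongr
  have h6 : ε * (|c| + M) ≤ n * (ε * (|c| + M)) :=
    le_mul_of_one_le_left (by positivity) hn1.le
  have h7 : 0 < n * ε := by positivity
  rw [← hεη]
  linarith

theorem integral_le_of_lipschitz [SecondCountableTopology X] (hφ : SatisfiesClosingLemma φ)
    {μ : ProbabilityMeasure X} (hμ : μ ∈ invariantProbabilityMeasures φ) {f : X → ℝ} {K : ℝ≥0}
    {M c : ℝ} (hf : LipschitzWith K f) (hM : ∀ x, |f x| ≤ M)
    (hc : ∀ m ∈ periodicOrbitMeasures φ, ∫ y, f y ∂m ≤ c) :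
    ∫ x, f x ∂(μ : Measure X) ≤ c := by
  refine le_of_forall_pos_le_add fun η hη => ?_
  have hcont : Continuous (Function.uncurry fun (x : X) (s : ℝ) => f (φ s x)) :=
    hf.continuous.comp (φ.continuous continuous_snd continuous_fst)
  have hint : Integrable (Function.uncurry fun (x : X) (s : ℝ) => f (φ s x))
      ((μ : Measure X).prod (volume.restrict (Ioc 0 1))) :=
    Integrable.of_bound hcont.measurable.stronglyMeasurable.aestronglyMeasurable M
      (Eventually.of_forall fun p => hM _)
  -- Fubini and invariance: averaging over unit time does not change the integral.
  have hswap : ∫ x, (∫ s in (0 : ℝ)..1, f (φ s x)) ∂(μ : Measure X) =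
      ∫ x, f x ∂(μ : Measure X) := by
    simp only [intervalIntegral.integral_of_le zero_le_one]
    rw [integral_integral_swap hint]
    have : ∀ s : ℝ, ∫ x, f (φ s x) ∂(μ : Measure X) = ∫ x, f x ∂(μ : Measure X) := fun s => by
      rw [← integral_map (hμ s).aemeasurable
        hf.continuous.measurable.stronglyMeasurable.aestronglyMeasurable, (hμ s).map_eq]
    simp [this]
  have hg_int : Integrable (fun x => ∫ s in (0 : ℝ)..1, f (φ s x)) (μ : Measure X) := by
    simp only [intervalIntegral.integral_of_le zero_le_one]
    exact hint.integral_prod_left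
  have hg_meas : Measurable fun x => ∫ s in (0 : ℝ)..1, f (φ s x) := by
    simp only [intervalIntegral.integral_of_le zero_le_one]
    exact hcont.measurable.stronglyMeasurable.integral_prod_right.measurable
  have hrec := (hμ 1).conservative.ae_frequently_mem_of_mem_nhds
  have hnonneg := integral_nonneg_of_ae_exists_birkhoffSum_pos (hμ 1)
    (g := fun y => (c + η) - ∫ s in (0 : ℝ)..1, f (φ s y))
    ((integrable_const _).sub hg_int) (measurable_const.sub hg_meas) (by
      filter_upwards [hrec] with x hx
      simp only [iterate_flow_one] at hx
      obtain ⟨n, hn⟩ := hφ.exists_integral_lt hf hM hη hc hx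
      exact ⟨n, by rw [birkhoffSum_integral_flow φ hf.continuous]; linarith⟩)
  rw [integral_sub (integrable_const _) hg_int, hswap, integral_const] at hnonneg
  simp at hnonneg
  linarith

/-- Minorants lie below `f`, so they inherit the periodic bound `c`, which survives the limit. -/
theorem integral_le_of_forall_periodic [SecondCountableTopology X]
    (hφ : SatisfiesClosingLemma φ) {μ : ProbabilityMeasure X}
    (hμ : μ ∈ invariantProbabilityMeasures φ) (f : X →ᵇ ℝ) {c : ℝ}
    (hc : ∀ m ∈ periodicOrbitMeasures φ, ∫ y, f y ∂m ≤ c) :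
    ∫ x, f x ∂(μ : Measure X) ≤ c := by
  have hM : ∀ x, |f x| ≤ ‖f‖ := f.norm_coe_le_norm
  have hlip := fun k : ℕ => lipschitzWith_lipschitzMinorant hM k
  have hmeas : ∀ (k : ℕ) (m : Measure X), AEStronglyMeasurable (lipschitzMinorant f k) m :=
    fun k m => (hlip k).continuous.measurable.stronglyMeasurable.aestronglyMeasurable
  refine le_of_tendsto' (tendsto_integral_of_dominated_convergence (fun _ => ‖f‖)
    (fun k : ℕ => hmeas k μ) (integrable_const _)
    (fun k => Eventually.of_forall fun x => abs_lipschitzMinorant_le hM k x)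
    (Eventually.of_forall fun x => tendsto_lipschitzMinorant f.continuous hM x)) fun k => ?_
  refine integral_le_of_lipschitz hφ hμ (hlip k) (fun x => abs_lipschitzMinorant_le hM k x)
    fun m hm => le_trans ?_ (hc m hm)
  have := isProbabilityMeasure_of_mem_convexHull (subset_convexHull ℝ≥0 _ hm)
  exact integral_mono (Integrable.of_bound (hmeas k m) ‖f‖
    (Eventually.of_forall fun x => abs_lipschitzMinorant_le hM k x)) (f.integrable m)
    (lipschitzMinorant_le hM k)

end Closing

theorem mainTheorem8 {X : Type*} [MetricSpace X] [MeasurableSpace X] [BorelSpace X]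
    [StandardBorelSpace X] (φ : Flow ℝ X) (hφ : SatisfiesClosingLemma φ) :
    (convexHull ℝ≥0 (periodicOrbitMeasures φ) ⊆
      (fun μ : ProbabilityMeasure X => (μ : Measure X)) '' invariantProbabilityMeasures φ) ∧
    Dense {μ : invariantProbabilityMeasures φ |
      ((μ : ProbabilityMeasure X) : Measure X) ∈ convexHull ℝ≥0 (periodicOrbitMeasures φ)} := by
  -- Topological Poincaré recurrence needs a countable basis.
  have := secondCountableTopology_of_metric_standardBorel X
  exact ⟨convexHull_periodicOrbitMeasures_subset φ, fun μ =>
    mem_closure_of_forall_integral_le φ μ fun f _ hc =>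
      integral_le_of_forall_periodic hφ μ.2 f hc⟩
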